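/- For a finite graph $G$, a configuration of $k$ pebbles is a multiset of $k$ vertices of $G$. A pebbling move removes two pebbles from a vertex and places one pebble on one of its neighbours. A configuration is solvable if for every vertex $v$ some finite (possibly empty) sequence of pebbling moves leads to a configuration with a pebble on $v$. Let $P_{1/2}(G)$ be the least $k$ such that a configuration chosen uniformly at random among all multisets of $k$ vertices of $G$ is solvable with probability at least $1/2$. Let $G_1\times G_2$ denote the Cartesian product of graphs, and let $Q_n$ be the $n$-dimensional hypercube. The threshold version of Graham's product conjecture fails: there is no real constant $C$ such that $$P_{1/2}(G_1\times G_2)\le C\,P_{1/2}(G_1)\,P_{1/2}(G_2)$$ for all finite connected graphs $G_1,G_2$ (and hence none for all finite nonempty graphs). Indeed hypercubes already provide the counterexample: there is no real constant $C$ such that $P_{1/2}(Q_n\times Q_n)\le C\,P_{1/2}(Q_n)^2$ for all $n\ge 1$. -/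

import Mathlib

/-- A configuration of unlabelled pebbles on the vertices of a graph is a multiset of vertices.
A pebbling move removes two pebbles from a vertex `u` and places one pebble on a neighbour `w`
of `u`. -/
def PebblingMove {V : Type*} (G : SimpleGraph V) (D D' : Multiset V) : Prop :=
  ∃ (u w : V) (E : Multiset V), G.Adj u w ∧ D = u ::ₘ u ::ₘ E ∧ D' = w ::ₘ E

/-- `D` is `v`-solvable if some finite (possibly empty) sequence of pebbling moves leads from `D`
to a configuration with a pebble on `v`. -/
def VertexSolvable {V : Type*} (G : SimpleGraph V) (D : Multiset V) (v : V) : Prop :=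
  ∃ D' : Multiset V, Relation.ReflTransGen (PebblingMove G) D D' ∧ v ∈ D'

/-- A configuration is solvable if it is `v`-solvable for every vertex `v`. -/
def PebblingSolvable {V : Type*} (G : SimpleGraph V) (D : Multiset V) : Prop :=
  ∀ v : V, VertexSolvable G D v

/-- The probability that a configuration of `k` pebbles on the vertices of a finite graph `G`,
chosen uniformly at random among all multisets of `k` vertices, is solvable. -/
noncomputable def solvableProb {V : Type*} (G : SimpleGraph V) (k : ℕ) : ℝ :=
  (Nat.card {D : Sym V k // PebblingSolvable G (D : Multiset V)} : ℝ) / (Nat.card (Sym V k) : ℝ)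

/-- `P_{1/2}(G)`: the least number `k` of pebbles such that a uniformly random configuration of
`k` pebbles on `G` is solvable with probability at least `1 / 2`. For a finite nonempty graph such
`k` exists, because the probability that every vertex carries a pebble tends to `1`. -/
noncomputable def pebblingHalf {V : Type*} (G : SimpleGraph V) : ℕ :=
  sInf {k : ℕ | (1 / 2 : ℝ) ≤ solvableProb G k}

/-- The `n`-dimensional hypercube: binary strings of length `n`, adjacent when they differ in
exactly one coordinate. -/
def hypercubeGraph (n : ℕ) : SimpleGraph (Fin n → Bool) where
  Adj x y := hammingDist x y = 1
  symm := ⟨fun x y h => by rw [hammingDist_comm]; exact h⟩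
  loopless := ⟨fun x h => by simp at h⟩

/-! Write P(n) for `pebblingHalf (hypercubeGraph n)`. As Q_n × Q_n is Q_{2n}, a constant C would
give P(2n) ≤ c P(n)² for a natural c ≥ 1, so c P(n) at most squares when n doubles. Two estimates
contradict this.

Upper bound (`half_le_solvableProb_hypercube`): for each fixed q and all large n, P(n) ≤ 2^n / q.
With few exceptions, every vertex has four pebbles on some vertex at distance two, which can be
moved to it. Thus c P(d) ≤ 2^d / 2 for some d, and repeated doubling gives P(ad) ≤ 2^(ad) / 2^a for
every power of two a.

Lower bound (`solvableProb_hypercube_lt_half`): with N = 2^(ad) vertices and at most N / 2^a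
pebbles, balls of radius d are so small that most likely none holds d + 1 pebbles. Without such a
cluster no pebble can travel distance d (`exists_groups_of_reflTransGen`), and the balls around the
pebbles do not cover the cube. So P(ad) > N / 2^a for large a. -/

/-! ### Isomorphism invariance and products of hypercubes. -/

theorem PebblingMove.map {V W : Type*} {G : SimpleGraph V} {H : SimpleGraph W} (f : G →g H)
    {D D' : Multiset V} (h : PebblingMove G D D') : PebblingMove H (D.map f) (D'.map f) := by
  obtain ⟨u, w, E, huw, rfl, rfl⟩ := h
  exact ⟨f u, f w, E.map f, f.map_adj huw, by simp, by simp⟩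

theorem VertexSolvable.map {V W : Type*} {G : SimpleGraph V} {H : SimpleGraph W} (f : G →g H)
    {D : Multiset V} {v : V} (h : VertexSolvable G D v) : VertexSolvable H (D.map f) (f v) := by
  obtain ⟨D', hD', hv⟩ := h
  exact ⟨D'.map f, hD'.lift (Multiset.map f) fun _ _ => PebblingMove.map f,
    Multiset.mem_map_of_mem f hv⟩

theorem PebblingSolvable.map {V W : Type*} {G : SimpleGraph V} {H : SimpleGraph W} (e : G ≃g H)
    {D : Multiset V} (h : PebblingSolvable G D) : PebblingSolvable H (D.map e) := by
  intro w
  simpa using (h (e.symm w)).map e.toHom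

theorem pebblingSolvable_map_iff {V W : Type*} {G : SimpleGraph V} {H : SimpleGraph W}
    (e : G ≃g H) {D : Multiset V} : PebblingSolvable H (D.map e) ↔ PebblingSolvable G D := by
  refine ⟨fun h => ?_, PebblingSolvable.map e⟩
  simpa [Multiset.map_map] using h.map e.symm

theorem solvableProb_congr {V W : Type*} {G : SimpleGraph V} {H : SimpleGraph W} (e : G ≃g H)
    (k : ℕ) : solvableProb G k = solvableProb H k := by
  unfold solvableProb
  rw [Nat.card_congr (Sym.equivCongr e.toEquiv), Nat.card_congr
    ((Sym.equivCongr (n := k) e.toEquiv).subtypeEquiv (q := fun D : Sym W k => PebblingSolvable H (D : Multiset W)) ?_)]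
  intro D
  simpa [Sym.equivCongr] using (pebblingSolvable_map_iff e (D := (D : Multiset V))).symm

theorem pebblingHalf_congr {V W : Type*} {G : SimpleGraph V} {H : SimpleGraph W} (e : G ≃g H) :
    pebblingHalf G = pebblingHalf H := by
  simp only [pebblingHalf, solvableProb_congr e]

theorem hammingDist_append {m n : ℕ} (x x' : Fin m → Bool) (y y' : Fin n → Bool) :
    hammingDist (Fin.append x y) (Fin.append x' y') = hammingDist x x' + hammingDist y y' := by
  simp [hammingDist, Finset.card_filter, Fin.sum_univ_add]

/-- The product of two hypercubes is a hypercube. -/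
def hypercubeBoxProdIso (m n : ℕ) :
    SimpleGraph.boxProd (hypercubeGraph m) (hypercubeGraph n) ≃g hypercubeGraph (m + n) where
  toEquiv := Fin.appendEquiv m n
  map_rel_iff' := by
    rintro ⟨x, y⟩ ⟨x', y'⟩
    simp only [Fin.appendEquiv, Equiv.coe_fn_mk, hypercubeGraph, SimpleGraph.boxProd_adj,
      hammingDist_append]
    rw [← hammingDist_eq_zero (x := x), ← hammingDist_eq_zero (x := y)]
    omega

/-! ### Connectedness and degrees of hypercubes. -/

/-- The binary string obtained from `v` by flipping the coordinates in `A`. -/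
def flipCoords {n : ℕ} (v : Fin n → Bool) (A : Finset (Fin n)) : Fin n → Bool :=
  fun i => if i ∈ A then !v i else v i

@[simp] theorem flipCoords_empty {n : ℕ} (v : Fin n → Bool) : flipCoords v ∅ = v := by
  ext; simp [flipCoords]

theorem flipCoords_injective {n : ℕ} (v : Fin n → Bool) :
    Function.Injective (flipCoords v) := by
  intro A B h
  ext i
  have := congrFun h i
  by_cases hA : i ∈ A <;> by_cases hB : i ∈ B <;> simp_all [flipCoords]

theorem flipCoords_filter_ne {n : ℕ} (v w : Fin n → Bool) :
    flipCoords v {i | v i ≠ w i} = w := by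
  ext i
  cases hv : v i <;> cases hw : w i <;> simp [flipCoords, hv, hw]

theorem hypercubeGraph_adj_flipCoords_insert {n : ℕ} (v : Fin n → Bool) {A : Finset (Fin n)}
    {i : Fin n} (hi : i ∉ A) :
    (hypercubeGraph n).Adj (flipCoords v A) (flipCoords v (insert i A)) := by
  change hammingDist _ _ = 1
  rw [hammingDist, Finset.card_eq_one]
  refine ⟨i, ?_⟩
  ext j
  by_cases hj : j = i
  · subst hj; simp [flipCoords, hi]
  · simp [flipCoords, hj]

theorem hypercubeGraph_connected (n : ℕ) : (hypercubeGraph n).Connected := by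
  have key : ∀ (v : Fin n → Bool) (A : Finset (Fin n)),
      (hypercubeGraph n).Reachable v (flipCoords v A) := by
    intro v A
    induction A using Finset.induction_on with
    | empty => simp
    | insert i A hi ih => exact ih.trans (hypercubeGraph_adj_flipCoords_insert v hi).reachable
  rw [SimpleGraph.connected_iff]
  refine ⟨fun v w => ?_, inferInstance⟩
  simpa [flipCoords_filter_ne] using key v {i | v i ≠ w i}

open Classical in
theorem hypercubeGraph_degree_le (n : ℕ) (v : Fin n → Bool) : (hypercubeGraph n).degree v ≤ n := by
  have : (hypercubeGraph n).neighborFinset v ⊆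
      (Finset.univ : Finset (Fin n)).image fun i => flipCoords v {i} := by
    intro w hw
    rw [SimpleGraph.mem_neighborFinset] at hw
    obtain ⟨i, hi⟩ := Finset.card_eq_one.1 (show hammingDist v w = 1 from hw)
    refine Finset.mem_image.2 ⟨i, Finset.mem_univ _, ?_⟩
    rw [← hi, flipCoords_filter_ne]
  simpa using (Finset.card_le_card this).trans Finset.card_image_le

/-! ### Counting multisets, and probabilities as counts. -/

theorem add_mul_multichoose (N k : ℕ) :
    (N + k) * N.multichoose k = (k + 1) * N.multichoose (k + 1) := by
  rcases N with _ | N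
  · rcases k with _ | k <;> simp
  · rw [Nat.multichoose_eq, Nat.multichoose_eq]
    have := Nat.add_one_mul_choose_eq (N + k) k
    have e1 : N + 1 + k - 1 = N + k := by omega
    have e2 : N + 1 + (k + 1) - 1 = N + k + 1 := by omega
    rw [e1, e2]
    linarith

/-- Each of the j added elements multiplies the count by (N + k) / (k + 1) for some k < r + j, hence
by at least N / (r + j). -/
theorem pow_mul_multichoose_le (N r j : ℕ) :
    N ^ j * N.multichoose r ≤ (r + j) ^ j * N.multichoose (r + j) := by
  induction j with
  | zero => simp
  | succ j ih =>
    calc N ^ (j + 1) * N.multichoose r = N * (N ^ j * N.multichoose r) := by ring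
      _ ≤ N * ((r + j) ^ j * N.multichoose (r + j)) := by gcongr
      _ ≤ (N + (r + j)) * ((r + j) ^ j * N.multichoose (r + j)) := by gcongr; omega
      _ = (r + j) ^ j * ((r + j + 1) * N.multichoose (r + j + 1)) := by
        rw [← add_mul_multichoose]; ring
      _ ≤ (r + (j + 1)) ^ j * ((r + j + 1) * N.multichoose (r + j + 1)) := by gcongr; omega
      _ = _ := by rw [← add_assoc]; ring

/-- At density about 1 / q the ratio (N + k) / (k + 1) is at most q + 1, and it stays so as k grows.
-/
theorem multichoose_add_le {N k q : ℕ} (h : N ≤ q * (k + 1)) (j : ℕ) :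
    N.multichoose (k + j) ≤ (q + 1) ^ j * N.multichoose k := by
  induction j with
  | zero => simp
  | succ j ih =>
    have h1 : (k + j + 1) * N.multichoose (k + j + 1) ≤
        (k + j + 1) * ((q + 1) * N.multichoose (k + j)) := by
      rw [← add_mul_multichoose, ← mul_assoc]
      gcongr
      nlinarith
    calc N.multichoose (k + (j + 1)) ≤ (q + 1) * N.multichoose (k + j) :=
        Nat.le_of_mul_le_mul_left h1 (by omega)
      _ ≤ (q + 1) * ((q + 1) ^ j * N.multichoose k) := by gcongr
      _ = _ := by ring

open Classical in
theorem solvableProb_eq {V : Type*} [Fintype V] [DecidableEq V] (G : SimpleGraph V) (k : ℕ) :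
    solvableProb G k = (Finset.card {D : Sym V k | PebblingSolvable G (D : Multiset V)} : ℝ) /
      ((Fintype.card V).multichoose k : ℝ) := by
  rw [solvableProb, Nat.card_eq_fintype_card, Nat.card_eq_fintype_card, Fintype.card_subtype,
    Sym.card_sym_eq_multichoose]

theorem multichoose_pos {N : ℕ} (hN : 0 < N) (k : ℕ) : 0 < N.multichoose k := by
  rw [Nat.multichoose_eq]
  exact Nat.choose_pos (by omega)

open Classical in
theorem half_le_solvableProb {V : Type*} [Fintype V] [DecidableEq V] [Nonempty V] {G : SimpleGraph V} {k : ℕ}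
    (h : 2 * Finset.card {D : Sym V k | ¬ PebblingSolvable G (D : Multiset V)} ≤
      (Fintype.card V).multichoose k) : 1 / 2 ≤ solvableProb G k := by
  have h1 := Finset.card_filter_add_card_filter_not (s := (Finset.univ : Finset (Sym V k)))
    (fun D => PebblingSolvable G (D : Multiset V))
  rw [Finset.card_univ, Sym.card_sym_eq_multichoose] at h1
  have h2 : (0 : ℝ) < (Fintype.card V).multichoose k := by
    exact_mod_cast multichoose_pos Fintype.card_pos k
  rw [solvableProb_eq, div_le_div_iff₀ two_pos h2, one_mul]
  norm_cast
  omega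

open Classical in
theorem solvableProb_lt_half {V : Type*} [Fintype V] [DecidableEq V] [Nonempty V] {G : SimpleGraph V} {k : ℕ}
    (h : 2 * Finset.card {D : Sym V k | PebblingSolvable G (D : Multiset V)} <
      (Fintype.card V).multichoose k) : solvableProb G k < 1 / 2 := by
  have h2 : (0 : ℝ) < (Fintype.card V).multichoose k := by
    exact_mod_cast multichoose_pos Fintype.card_pos k
  rw [solvableProb_eq, div_lt_div_iff₀ h2 two_pos, one_mul]
  norm_cast
  omega

/-! ### Upper bound: a small positive density suffices. -/

/-- Few multisets have multiplicity less than `r` at every point of a large set `S`: adding `r`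
copies of each point of a `t`-subset of `S` is injective. -/
theorem card_count_lt_mul_choose_le {V : Type*} [Fintype V] [DecidableEq V] (S : Finset V)
    (r k t : ℕ) :
    Finset.card {D : Sym V k | ∀ u ∈ S, (D : Multiset V).count u < r} * S.card.choose t ≤
      (Fintype.card V).multichoose (k + r * t) := by
  rw [← Fintype.card_subtype, ← Finset.card_powersetCard, ← Fintype.card_coe,
    ← Fintype.card_prod, ← Sym.card_sym_eq_multichoose V]
  refine Fintype.card_le_of_injective
    (fun p => (⟨(p.1.1 : Multiset V) + r • p.2.1.val, ?_⟩ : Sym V (k + r * t))) ?_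
  · have := (Finset.mem_powersetCard.1 p.2.2).2
    simp [this]
  · rintro ⟨⟨D, hD⟩, ⟨T, hT⟩⟩ ⟨⟨D', hD'⟩, ⟨T', hT'⟩⟩ h
    rw [Finset.mem_powersetCard] at hT hT'
    have h0 : (D : Multiset V) + r • T.val = (D' : Multiset V) + r • T'.val :=
      congrArg Subtype.val h
    -- Inside S, the set T consists of the points of multiplicity at least r in the sum.
    have hTT : T = T' := by
      ext u
      have h1 := congrArg (Multiset.count u) h0
      simp only [Multiset.count_add, Multiset.count_nsmul, Multiset.count_eq_of_nodup T.nodup,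
        Multiset.count_eq_of_nodup T'.nodup, Finset.mem_val] at h1
      by_cases hu : u ∈ S
      · have h2 := hD u hu
        have h3 := hD' u hu
        by_cases ha : u ∈ T <;> by_cases hb : u ∈ T' <;> simp [ha, hb] at h1 ⊢ <;> omega
      · exact ⟨fun ha => absurd (hT.1 ha) hu, fun ha => absurd (hT'.1 ha) hu⟩
    subst hTT
    have hDD : D = D' := Sym.coe_injective (add_right_cancel h0)
    subst hDD
    rfl

theorem vertexSolvable_of_four_le_count {V : Type*} [DecidableEq V] {G : SimpleGraph V}
    {D : Multiset V} {u w v : V} (huw : G.Adj u w) (hwv : G.Adj w v) (h : 4 ≤ D.count u) :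
    VertexSolvable G D v := by
  obtain ⟨E, rfl⟩ := Multiset.le_iff_exists_add.1 (Multiset.le_count_iff_replicate_le.1 h)
  refine ⟨v ::ₘ E, ?_, Multiset.mem_cons_self _ _⟩
  refine .head (b := w ::ₘ u ::ₘ u ::ₘ E) ⟨u, w, u ::ₘ u ::ₘ E, huw, ?_, rfl⟩
    (.head (b := w ::ₘ w ::ₘ E) ⟨u, w, w ::ₘ E, huw, ?_, rfl⟩
      (.single ⟨w, v, E, hwv, rfl, rfl⟩))
  · simp [Multiset.replicate_succ, Multiset.replicate_zero]
  · rw [Multiset.cons_swap w u, Multiset.cons_swap w u]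

/-- The vertices of the hypercube at distance two from `v`. -/
def distTwoSet {n : ℕ} (v : Fin n → Bool) : Finset (Fin n → Bool) :=
  (Finset.powersetCard 2 Finset.univ).image (flipCoords v)

theorem card_distTwoSet {n : ℕ} (v : Fin n → Bool) : (distTwoSet v).card = n.choose 2 := by
  rw [distTwoSet, Finset.card_image_of_injective _ (flipCoords_injective v)]
  simp

theorem exists_adj_adj_of_mem_distTwoSet {n : ℕ} {v u : Fin n → Bool} (hu : u ∈ distTwoSet v) :
    ∃ w, (hypercubeGraph n).Adj u w ∧ (hypercubeGraph n).Adj w v := by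
  obtain ⟨A, hA, rfl⟩ := Finset.mem_image.1 hu
  obtain ⟨i, j, hij, rfl⟩ := Finset.card_eq_two.1 (Finset.mem_powersetCard.1 hA).2
  refine ⟨flipCoords v {j}, (hypercubeGraph_adj_flipCoords_insert v (by simpa using hij)).symm, ?_⟩
  simpa using (hypercubeGraph_adj_flipCoords_insert v (Finset.notMem_empty j)).symm

-- Union bound over the unreached vertex v: every vertex at distance two from v then holds fewer
-- than four pebbles.
open Classical in
theorem card_not_pebblingSolvable_hypercube_mul_le (n k t : ℕ) :
    Finset.card {D : Sym (Fin n → Bool) k |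
        ¬ PebblingSolvable (hypercubeGraph n) (D : Multiset (Fin n → Bool))} *
      (n.choose 2).choose t ≤ 2 ^ n * (2 ^ n).multichoose (k + 4 * t) := by
  have hsub : ({D : Sym (Fin n → Bool) k |
      ¬ PebblingSolvable (hypercubeGraph n) (D : Multiset (Fin n → Bool))} : Finset _) ⊆
      (Finset.univ : Finset (Fin n → Bool)).biUnion fun v =>
        {D : Sym (Fin n → Bool) k | ∀ u ∈ distTwoSet v, (D : Multiset _).count u < 4} := by
    intro D hD
    simp only [Finset.mem_filter, Finset.mem_univ, true_and, PebblingSolvable, not_forall] at hD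
    obtain ⟨v, hv⟩ := hD
    simp only [Finset.mem_biUnion, Finset.mem_univ, true_and, Finset.mem_filter]
    refine ⟨v, fun u hu => ?_⟩
    by_contra! hc
    obtain ⟨w, huw, hwv⟩ := exists_adj_adj_of_mem_distTwoSet hu
    exact hv (vertexSolvable_of_four_le_count huw hwv hc)
  calc _ ≤ (∑ v : Fin n → Bool, Finset.card
        {D : Sym (Fin n → Bool) k | ∀ u ∈ distTwoSet v, (D : Multiset _).count u < 4}) *
        (n.choose 2).choose t :=
      Nat.mul_le_mul_right _ ((Finset.card_le_card hsub).trans Finset.card_biUnion_le)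
    _ ≤ ∑ v : Fin n → Bool, (2 ^ n).multichoose (k + 4 * t) := by
      rw [Finset.sum_mul]
      refine Finset.sum_le_sum fun v _ => ?_
      simpa [card_distTwoSet] using card_count_lt_mul_choose_le (distTwoSet v) 4 k t
    _ = _ := by simp

/-- With m = n.choose 2, about n² / 2, the binomial coefficient is at least (m + 1 - n)^n / n!, and
n! ≤ n^n. -/
theorem pow_le_choose_choose_two {n x : ℕ} (h : 2 * x + 3 ≤ n) :
    x ^ n ≤ (n.choose 2).choose n := by
  have h1 : x * n ≤ n.choose 2 + 1 - n := by
    have h2 : n.choose 2 = n * (n - 1) / 2 := Nat.choose_two_right n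
    obtain ⟨m, rfl⟩ : ∃ m, n = 2 * x + 3 + m := ⟨n - (2 * x + 3), by omega⟩
    have h3 : 2 * (x * (2 * x + 3 + m) + (2 * x + 3 + m)) ≤
        (2 * x + 3 + m) * (2 * x + 3 + m - 1) := by
      rw [show 2 * x + 3 + m - 1 = 2 * x + 2 + m by omega]
      nlinarith
    omega
  have h4 : x ^ n * n.factorial ≤ (n.choose 2).choose n * n.factorial :=
    calc x ^ n * n.factorial ≤ x ^ n * n ^ n := by gcongr; exact Nat.factorial_le_pow n
      _ = (x * n) ^ n := by rw [mul_pow]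
      _ ≤ (n.choose 2 + 1 - n) ^ n := by gcongr
      _ ≤ _ := Nat.pow_sub_le_descFactorial _ _
      _ = _ := by rw [Nat.descFactorial_eq_factorial_mul_choose, mul_comm]
  exact Nat.le_of_mul_le_mul_right h4 n.factorial_pos

/-- Taking x = 4(q + 1)^4 in `pow_le_choose_choose_two`, the factor (q + 1)^(4n) pays for the 4n
added pebbles, and the remaining 4^n beats the 2^n of the union bound. -/
theorem two_mul_le_multichoose_of_mul_choose_le {q n k B : ℕ} (hn : 8 * (q + 1) ^ 4 + 3 ≤ n)
    (hN : 2 ^ n ≤ q * (k + 1))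
    (hB : B * (n.choose 2).choose n ≤ 2 ^ n * (2 ^ n).multichoose (k + 4 * n)) :
    2 * B ≤ (2 ^ n).multichoose k := by
  have h1 : B * (4 * (q + 1) ^ 4) ^ n ≤ 2 ^ n * (((q + 1) ^ 4) ^ n * (2 ^ n).multichoose k) :=
    calc B * (4 * (q + 1) ^ 4) ^ n ≤ B * (n.choose 2).choose n :=
          Nat.mul_le_mul_left _ (pow_le_choose_choose_two (by omega))
      _ ≤ 2 ^ n * (2 ^ n).multichoose (k + 4 * n) := hB
      _ ≤ 2 ^ n * ((q + 1) ^ (4 * n) * (2 ^ n).multichoose k) :=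
          Nat.mul_le_mul_left _ (multichoose_add_le hN _)
      _ = 2 ^ n * (((q + 1) ^ 4) ^ n * (2 ^ n).multichoose k) := by rw [pow_mul]
  have h4 : 2 ≤ 2 ^ n := Nat.le_self_pow (by omega) 2
  have h5 : 0 < ((q + 1) ^ 4) ^ n := by positivity
  have h6 : (4 : ℕ) ^ n = 2 ^ n * 2 ^ n := by rw [← mul_pow]; norm_num
  rw [mul_pow, h6] at h1
  generalize (2 ^ n).multichoose k = M at *
  generalize ((q + 1) ^ 4) ^ n = Q at *
  generalize 2 ^ n = N at *
  have h2 : (B * N) * (N * Q) ≤ M * (N * Q) := by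
    calc (B * N) * (N * Q) = B * (N * N * Q) := by ring
      _ ≤ N * (Q * M) := h1
      _ = M * (N * Q) := by ring
  have h3 : B * N ≤ M := Nat.le_of_mul_le_mul_right h2 (Nat.mul_pos (by omega) h5)
  calc 2 * B = B * 2 := mul_comm _ _
    _ ≤ B * N := Nat.mul_le_mul_left _ h4
    _ ≤ M := h3

/-- Any positive density of pebbles suffices on large hypercubes. -/
theorem half_le_solvableProb_hypercube {q : ℕ} (hq : 0 < q) {n : ℕ}
    (hn : 8 * (q + 1) ^ 4 + 3 ≤ n) :
    1 / 2 ≤ solvableProb (hypercubeGraph n) (2 ^ n / q) := by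
  classical
  apply half_le_solvableProb
  have hc : Fintype.card (Fin n → Bool) = 2 ^ n := by simp
  rw [hc]
  exact two_mul_le_multichoose_of_mul_choose_le hn (Nat.lt_mul_div_succ _ hq).le
    (card_not_pebblingSolvable_hypercube_mul_le n _ n)

/-! ### Lower bound: without clusters pebbles stay local. -/

open Classical in
/-- The vertices that are joined to `v` by a walk of length at most `t`. -/
noncomputable def walkBall {V : Type*} [Fintype V] (G : SimpleGraph V) (t : ℕ) (v : V) :
    Finset V := {x | ∃ p : G.Walk v x, p.length ≤ t}

theorem mem_walkBall {V : Type*} [Fintype V] {G : SimpleGraph V} {t : ℕ} {v x : V} :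
    x ∈ walkBall G t v ↔ ∃ p : G.Walk v x, p.length ≤ t := by
  simp [walkBall]

theorem mem_walkBall_comm {V : Type*} [Fintype V] {G : SimpleGraph V} {t : ℕ} {v x : V} :
    x ∈ walkBall G t v ↔ v ∈ walkBall G t x := by
  simp only [mem_walkBall]
  exact ⟨fun ⟨p, hp⟩ => ⟨p.reverse, by simpa⟩, fun ⟨p, hp⟩ => ⟨p.reverse, by simpa⟩⟩

theorem walkBall_mono {V : Type*} [Fintype V] {G : SimpleGraph V} {s t : ℕ} (h : s ≤ t) (v : V) :
    walkBall G s v ⊆ walkBall G t v := by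
  intro x
  simp only [mem_walkBall]
  exact fun ⟨p, hp⟩ => ⟨p, hp.trans h⟩

theorem self_mem_walkBall {V : Type*} [Fintype V] (G : SimpleGraph V) (t : ℕ) (v : V) :
    v ∈ walkBall G t v :=
  mem_walkBall.2 ⟨.nil, by simp⟩

theorem walkBall_subset_of_adj {V : Type*} [Fintype V] {G : SimpleGraph V} {t : ℕ} {u w : V}
    (h : G.Adj u w) : walkBall G t u ⊆ walkBall G (t + 1) w := by
  intro x
  simp only [mem_walkBall]
  exact fun ⟨p, hp⟩ => ⟨.cons h.symm p, by simpa⟩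

open Classical in
theorem card_walkBall_le {V : Type*} [Fintype V] {G : SimpleGraph V} {Δ : ℕ}
    (hΔ : ∀ v, G.degree v ≤ Δ) (t : ℕ) (v : V) : (walkBall G t v).card ≤ (Δ + 1) ^ t := by
  induction t generalizing v with
  | zero =>
    have : walkBall G 0 v ⊆ {v} := by
      intro x hx
      obtain ⟨p, hp⟩ := mem_walkBall.1 hx
      exact Finset.mem_singleton.2 (p.eq_of_length_eq_zero (by omega)).symm
    simpa using Finset.card_le_card this
  | succ t ih =>
    have : walkBall G (t + 1) v ⊆ insert v ((G.neighborFinset v).biUnion (walkBall G t)) := by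
      intro x hx
      obtain ⟨p, hp⟩ := mem_walkBall.1 hx
      cases p with
      | nil => simp
      | cons h p =>
        refine Finset.mem_insert_of_mem (Finset.mem_biUnion.2 ⟨_, by simpa using h, ?_⟩)
        exact mem_walkBall.2 ⟨p, by simpa using hp⟩
    calc _ ≤ _ := Finset.card_le_card this
      _ ≤ ((G.neighborFinset v).biUnion (walkBall G t)).card + 1 := Finset.card_insert_le _ _
      _ ≤ (G.neighborFinset v).card * (Δ + 1) ^ t + 1 := by
        gcongr; exact Finset.card_biUnion_le_card_mul _ _ _ fun u _ => ih u
      _ ≤ Δ * (Δ + 1) ^ t + (Δ + 1) ^ t := by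
        gcongr
        · simpa using hΔ v
        · exact Nat.one_le_pow _ _ (by omega)
      _ = _ := by ring

/-- If no ball of radius `h` contains more than `h` pebbles of `D`, then after any sequence of
moves the pebbles come from disjoint groups of pebbles of `D`, each near the pebble it produced. -/
theorem exists_groups_of_reflTransGen {V : Type*} [Fintype V] {G : SimpleGraph V}
    {D D' : Multiset V} {h : ℕ} (h0 : 0 < h)
    (hD : ∀ (u : V), ∀ T ≤ D, (∀ x ∈ T, x ∈ walkBall G h u) → T.card ≤ h)
    (hr : Relation.ReflTransGen (PebblingMove G) D D') :
    ∃ M : Multiset (V × Multiset V), M.map Prod.fst = D' ∧ (M.map Prod.snd).sum ≤ D ∧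
      ∀ p ∈ M, ∃ t < h, t < p.2.card ∧ ∀ x ∈ p.2, x ∈ walkBall G t p.1 := by
  classical
  induction hr with
  | refl =>
    refine ⟨D.map fun v => (v, {v}), by simp, by simp [Multiset.map_map], ?_⟩
    intro p hp
    obtain ⟨v, -, rfl⟩ := Multiset.mem_map.1 hp
    exact ⟨0, h0, by simp, by simpa using self_mem_walkBall G 0 v⟩
  | tail _ hm ih =>
    obtain ⟨u, w, E, huw, rfl, rfl⟩ := hm
    obtain ⟨M, hM1, hM2, hM3⟩ := ih
    obtain ⟨a, ha, hau, hM1⟩ := (Multiset.map_eq_cons _ _ _ _).2 hM1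
    obtain ⟨b, hb, hbu, hM1⟩ := (Multiset.map_eq_cons _ _ _ _).2 hM1
    obtain ⟨M', rfl⟩ : ∃ M', M = a ::ₘ b ::ₘ M' :=
      ⟨(M.erase a).erase b, by rw [Multiset.cons_erase hb, Multiset.cons_erase ha]⟩
    simp only [Multiset.erase_cons_head] at hM1
    simp only [Multiset.map_cons, Multiset.sum_cons, ← add_assoc] at hM2
    obtain ⟨s, hs, hsa, hsb⟩ := hM3 a (by simp)
    obtain ⟨t, ht, hta, htb⟩ := hM3 b (by simp)
    have hball : ∀ x ∈ a.2 + b.2, x ∈ walkBall G (max s t + 1) w := by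
      intro x hx
      apply walkBall_subset_of_adj huw
      rcases Multiset.mem_add.1 hx with hx | hx
      · exact walkBall_mono (le_max_left _ _) _ (hau ▸ hsb x hx)
      · exact walkBall_mono (le_max_right _ _) _ (hbu ▸ htb x hx)
    have hle : (a.2 + b.2).card ≤ h :=
      hD w _ (le_trans (Multiset.le_add_right _ _) hM2) fun x hx =>
        walkBall_mono (by omega) _ (hball x hx)
    rw [Multiset.card_add] at hle
    refine ⟨(w, a.2 + b.2) ::ₘ M', by simp [hM1], by simpa [← add_assoc] using hM2, ?_⟩
    intro p hp
    rcases Multiset.mem_cons.1 hp with rfl | hp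
    -- The group sizes are at least s + 1 and t + 1, so their sum exceeds max s t + 1; since it is
    -- at most h, the new radius is again below h.
    · exact ⟨max s t + 1, by omega, by rw [Multiset.card_add]; omega, hball⟩
    · exact hM3 p (by simp [hp])

theorem VertexSolvable.exists_mem_walkBall {V : Type*} [Fintype V] {G : SimpleGraph V}
    {D : Multiset V} {h : ℕ} {v : V} (hv : VertexSolvable G D v) (h0 : 0 < h)
    (hD : ∀ (u : V), ∀ T ≤ D, (∀ x ∈ T, x ∈ walkBall G h u) → T.card ≤ h) :
    ∃ x ∈ D, x ∈ walkBall G h v := by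
  obtain ⟨D', hr, hv⟩ := hv
  obtain ⟨M, rfl, hM2, hM3⟩ := exists_groups_of_reflTransGen h0 hD hr
  obtain ⟨p, hp, rfl⟩ := Multiset.mem_map.1 hv
  obtain ⟨t, hth, htp, hx⟩ := hM3 p hp
  obtain ⟨x, hxp⟩ := Multiset.card_pos_iff_exists_mem.1 (Nat.zero_lt_of_lt htp)
  refine ⟨x, ?_, walkBall_mono hth.le _ (hx x hxp)⟩
  exact Multiset.mem_of_le ((Multiset.single_le_sum (fun _ _ => zero_le) _
    (Multiset.mem_map_of_mem Prod.snd hp)).trans hM2) hxp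

/-- A solvable configuration with few pebbles has many pebbles in some small ball. -/
theorem PebblingSolvable.exists_cluster {V : Type*} [Fintype V] {G : SimpleGraph V}
    {D : Multiset V} {h b : ℕ} (hs : PebblingSolvable G D) (h0 : 0 < h)
    (hb : ∀ v, (walkBall G h v).card ≤ b) (hcard : D.card * b < Fintype.card V) :
    ∃ (u : V), ∃ T ≤ D, T.card = h + 1 ∧ ∀ x ∈ T, x ∈ walkBall G h u := by
  classical
  by_contra! hc
  have hD : ∀ (u : V), ∀ T ≤ D, (∀ x ∈ T, x ∈ walkBall G h u) → T.card ≤ h := by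
    intro u T hT hx
    by_contra! hlt
    induction T using Quotient.inductionOn with | h l => ?_
    -- An oversized cluster is trimmed to exactly h + 1 pebbles.
    have hl : ((l.take (h + 1) : List V) : Multiset V) ≤ (l : Multiset V) :=
      Multiset.coe_le.2 (List.take_sublist _ _).subperm
    obtain ⟨x, hxT, hxb⟩ := hc u _ (hl.trans hT) (by simpa using hlt)
    exact hxb (hx x (Multiset.mem_of_le hl hxT))
  have hcover : (Finset.univ : Finset V) ⊆ D.toFinset.biUnion (walkBall G h) := by
    intro v _
    obtain ⟨x, hxD, hxv⟩ := (hs v).exists_mem_walkBall h0 hD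
    exact Finset.mem_biUnion.2 ⟨x, by simpa using hxD, mem_walkBall_comm.1 hxv⟩
  have := calc Fintype.card V = (Finset.univ : Finset V).card := rfl
    _ ≤ (D.toFinset.biUnion (walkBall G h)).card := Finset.card_le_card hcover
    _ ≤ D.toFinset.card * b := Finset.card_biUnion_le_card_mul _ _ _ fun v _ => hb v
    _ ≤ D.card * b := Nat.mul_le_mul_right _ D.toFinset_card_le
  omega

-- Such a configuration is determined by the index i, an ordered j-tuple in B i and the remaining r
-- pebbles.
open Classical in
theorem card_exists_cluster_le {V ι : Type*} [Fintype V] [Fintype ι] (B : ι → Finset V) {b : ℕ}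
    (hb : ∀ i, (B i).card ≤ b) (r j : ℕ) :
    Finset.card {D : Sym V (r + j) | ∃ i, ∃ T ≤ (D : Multiset V), T.card = j ∧ ∀ x ∈ T, x ∈ B i} ≤
      Fintype.card ι * (b ^ j * (Fintype.card V).multichoose r) := by
  let f : (Fin j → V) × Sym V r → Sym V (r + j) := fun p =>
    ⟨p.2 + (List.ofFn p.1 : Multiset V), by simp⟩
  have hsub : ({D : Sym V (r + j) |
      ∃ i, ∃ T ≤ (D : Multiset V), T.card = j ∧ ∀ x ∈ T, x ∈ B i} : Finset _) ⊆
      (Finset.univ : Finset ι).biUnion fun i =>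
        ((Fintype.piFinset fun _ : Fin j => B i) ×ˢ (Finset.univ : Finset (Sym V r))).image f := by
    intro D hD
    obtain ⟨i, T, hT, hTj, hx⟩ := (Finset.mem_filter.1 hD).2
    obtain ⟨E, hE⟩ := Multiset.le_iff_exists_add.1 hT
    induction T using Quotient.inductionOn with | h l => ?_
    have hlj : l.length = j := by simpa using hTj
    subst hlj
    have hEr : E.card = r := by
      have := congrArg Multiset.card hE
      simp at this
      omega
    refine Finset.mem_biUnion.2 ⟨i, Finset.mem_univ _, Finset.mem_image.2
      ⟨(l.get, ⟨E, hEr⟩), ?_, ?_⟩⟩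
    · exact Finset.mem_product.2 ⟨Fintype.mem_piFinset.2 fun a => hx _ (List.get_mem l a),
        Finset.mem_univ _⟩
    · apply Sym.coe_injective
      refine Eq.trans ?_ ((add_comm _ _).trans hE.symm)
      change E + (List.ofFn l.get : Multiset V) = _
      rw [List.ofFn_get]
      rfl
  refine (Finset.card_le_card hsub).trans (Finset.card_biUnion_le_card_mul _ _ _ fun i _ => ?_)
  refine Finset.card_image_le.trans ?_
  rw [Finset.card_product, Fintype.card_piFinset_const, Finset.card_univ,
    Sym.card_sym_eq_multichoose]
  gcongr
  exact hb i

/-- In a graph of small degree, a sparse random configuration is unlikely to be solvable. -/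
theorem solvableProb_lt_half_of_walkBall {V : Type*} [Fintype V] [Nonempty V] {G : SimpleGraph V}
    {h b k : ℕ} (h0 : 0 < h) (hb : ∀ v, (walkBall G h v).card ≤ b)
    (hk : 2 * Fintype.card V * (b * k) ^ (h + 1) < Fintype.card V ^ (h + 1)) :
    solvableProb G k < 1 / 2 := by
  classical
  apply solvableProb_lt_half
  set N := Fintype.card V
  have hN : 0 < N := Fintype.card_pos
  have hcov : k * b < N := by
    by_contra! hc
    have h1 : N ^ (h + 1) ≤ (b * k) ^ (h + 1) := by
      rw [mul_comm b]; gcongr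
    have h2 := Nat.le_mul_of_pos_left ((b * k) ^ (h + 1)) (show 0 < 2 * N by omega)
    omega
  have hsub : ({D : Sym V k | PebblingSolvable G (D : Multiset V)} : Finset _) ⊆
      ({D : Sym V k | ∃ u, ∃ T ≤ (D : Multiset V), T.card = h + 1 ∧ ∀ x ∈ T, x ∈ walkBall G h u} :
        Finset _) := by
    intro D hD
    simp only [Finset.mem_filter, Finset.mem_univ, true_and] at hD ⊢
    exact hD.exists_cluster h0 hb (by simpa using hcov)
  have hle := Finset.card_le_card hsub
  rcases lt_or_ge k (h + 1) with hkh | hkh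
  · have hempty : ({D : Sym V k | ∃ u, ∃ T ≤ (D : Multiset V), T.card = h + 1 ∧
        ∀ x ∈ T, x ∈ walkBall G h u} : Finset _) = ∅ := by
      refine Finset.filter_eq_empty_iff.2 ?_
      rintro D - ⟨u, T, hT, hTc, -⟩
      have := Multiset.card_le_card hT
      simp at this
      omega
    rw [hempty, Finset.card_empty] at hle
    have := multichoose_pos hN k
    omega
  · obtain ⟨r, rfl⟩ : ∃ r, k = r + (h + 1) := ⟨k - (h + 1), by omega⟩
    replace hle := hle.trans (card_exists_cluster_le (walkBall G h) hb r (h + 1))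
    set A := Finset.card {D : Sym V (r + (h + 1)) | PebblingSolvable G (D : Multiset V)}
    refine Nat.lt_of_mul_lt_mul_left (a := N ^ (h + 1)) ?_
    calc N ^ (h + 1) * (2 * A) ≤
        N ^ (h + 1) * (2 * (N * (b ^ (h + 1) * N.multichoose r))) := by gcongr
      _ = 2 * N * b ^ (h + 1) * (N ^ (h + 1) * N.multichoose r) := by ring
      _ ≤ 2 * N * b ^ (h + 1) * ((r + (h + 1)) ^ (h + 1) * N.multichoose (r + (h + 1))) :=
        Nat.mul_le_mul_left _ (pow_mul_multichoose_le N r (h + 1))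
      _ = (2 * N * (b * (r + (h + 1))) ^ (h + 1)) * N.multichoose (r + (h + 1)) := by
        rw [mul_pow]; ring
      _ < _ := Nat.mul_lt_mul_of_pos_right hk (multichoose_pos hN _)

/-- The union over N = (2^a)^d centres costs d factors 2^a, while each of the d + 1 clustered
pebbles gains one. The spare factor absorbs the ball sizes. -/
theorem solvableProb_hypercube_lt_half {a d k : ℕ} (hd : 0 < d)
    (ha : 2 * ((a * d + 1) ^ d) ^ (d + 1) < 2 ^ a) (hk : k * 2 ^ a ≤ 2 ^ (a * d)) :
    solvableProb (hypercubeGraph (a * d)) k < 1 / 2 := by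
  classical
  refine solvableProb_lt_half_of_walkBall hd
    (card_walkBall_le (hypercubeGraph_degree_le (a * d)) d) ?_
  have hc : Fintype.card (Fin (a * d) → Bool) = 2 ^ (a * d) := by simp
  rw [hc]
  set b := (a * d + 1) ^ d
  set N := 2 ^ (a * d) with hN
  refine Nat.lt_of_mul_lt_mul_right (a := (2 ^ a) ^ (d + 1)) ?_
  calc 2 * N * (b * k) ^ (d + 1) * (2 ^ a) ^ (d + 1)
      = 2 * b ^ (d + 1) * (N * (k * 2 ^ a) ^ (d + 1)) := by simp only [mul_pow]; ring
    _ ≤ 2 * b ^ (d + 1) * (N * N ^ (d + 1)) := by gcongr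
    _ < 2 ^ a * (N * N ^ (d + 1)) := Nat.mul_lt_mul_of_pos_right ha (by positivity)
    _ = N ^ (d + 1) * (2 ^ a) ^ (d + 1) := by rw [pow_succ (2 ^ a), ← pow_mul 2 a d, ← hN]; ring

/-! ### Contradiction by repeated doubling. -/

theorem eventually_two_mul_pow_lt_two_pow (d : ℕ) :
    ∀ᶠ a : ℕ in Filter.atTop, 2 * ((a * d + 1) ^ d) ^ (d + 1) < 2 ^ a := by
  set e := d * (d + 1)
  have h1 := tendsto_pow_const_div_const_pow_of_one_lt e (r := (2 : ℝ)) one_lt_two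
  have h2 : (0 : ℝ) < 1 / (2 * (d + 1) ^ e) := by positivity
  filter_upwards [h1.eventually_lt_const h2, Filter.eventually_ge_atTop 1] with a ha ha1
  rw [div_lt_div_iff₀ (by positivity) (by positivity), one_mul] at ha
  have ha' : a ^ e * (2 * (d + 1) ^ e) < 2 ^ a := by exact_mod_cast ha
  calc 2 * ((a * d + 1) ^ d) ^ (d + 1) = 2 * (a * d + 1) ^ e := by rw [← pow_mul]
    _ ≤ 2 * (a * (d + 1)) ^ e := by gcongr; nlinarith
    _ = a ^ e * (2 * (d + 1) ^ e) := by rw [mul_pow]; ring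
    _ < _ := ha'

theorem not_exists_pebblingHalf_hypercube_le :
    ¬ ∃ C : ℝ, ∀ n : ℕ, 1 ≤ n →
      (pebblingHalf (SimpleGraph.boxProd (hypercubeGraph n) (hypercubeGraph n)) : ℝ)
        ≤ C * (pebblingHalf (hypercubeGraph n) : ℝ) * (pebblingHalf (hypercubeGraph n) : ℝ) := by
  rintro ⟨C, hC⟩
  obtain ⟨c, hcC⟩ := exists_nat_ge (max C 1)
  have hc : 0 < c := by
    have : (1 : ℝ) ≤ c := (le_max_right _ _).trans hcC
    exact_mod_cast this
  have hstep : ∀ n, 1 ≤ n → pebblingHalf (hypercubeGraph (n + n)) ≤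
      c * pebblingHalf (hypercubeGraph n) * pebblingHalf (hypercubeGraph n) := by
    intro n hn
    have h1 := hC n hn
    rw [pebblingHalf_congr (hypercubeBoxProdIso n n)] at h1
    have h2 : (pebblingHalf (hypercubeGraph (n + n)) : ℝ) ≤
        c * pebblingHalf (hypercubeGraph n) * pebblingHalf (hypercubeGraph n) := by
      refine h1.trans ?_
      gcongr
      exact (le_max_left _ _).trans hcC
    exact_mod_cast h2
  -- The threshold for density 1 / (2c): the c makes the recursion a pure squaring, and the 2 is the
  -- initial gain that doubling amplifies.
  set d := 8 * (2 * c + 1) ^ 4 + 3 with hd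
  have hupper : ∀ n, d ≤ n → 1 / 2 ≤ solvableProb (hypercubeGraph n) (2 ^ n / (2 * c)) :=
    fun n hn => half_le_solvableProb_hypercube (by omega) hn
  have hiter : ∀ j, c * pebblingHalf (hypercubeGraph (2 ^ j * d)) * 2 ^ 2 ^ j ≤
      2 ^ (2 ^ j * d) := by
    intro j
    induction j with
    | zero =>
      have h1 : pebblingHalf (hypercubeGraph d) ≤ 2 ^ d / (2 * c) := Nat.sInf_le (hupper d le_rfl)
      have h2 := Nat.mul_le_of_le_div _ _ _ h1
      rw [show 2 ^ 0 * d = d by simp, pow_zero, pow_one]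
      linarith
    | succ j ih =>
      have h1 := hstep (2 ^ j * d) (Nat.mul_pos (by positivity) (by omega))
      rw [show 2 ^ j * d + 2 ^ j * d = 2 ^ (j + 1) * d by ring] at h1
      set p := pebblingHalf (hypercubeGraph (2 ^ j * d))
      calc c * pebblingHalf (hypercubeGraph (2 ^ (j + 1) * d)) * 2 ^ 2 ^ (j + 1)
          ≤ c * (c * p * p) * 2 ^ 2 ^ (j + 1) := by gcongr
        _ = (c * p * 2 ^ 2 ^ j) * (c * p * 2 ^ 2 ^ j) := by
          rw [show 2 ^ (j + 1) = 2 ^ j + 2 ^ j by ring, pow_add]; ring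
        _ ≤ 2 ^ (2 ^ j * d) * 2 ^ (2 ^ j * d) := Nat.mul_le_mul ih ih
        _ = _ := by rw [← pow_add]; congr 1; ring
  obtain ⟨j, hj⟩ := ((tendsto_pow_atTop_atTop_of_one_lt one_lt_two).eventually
    (eventually_two_mul_pow_lt_two_pow d)).exists
  have hlt := solvableProb_hypercube_lt_half (k := pebblingHalf (hypercubeGraph (2 ^ j * d)))
    (by omega) hj ((Nat.mul_le_mul_right _ (Nat.le_mul_of_pos_left _ hc)).trans (hiter j))
  -- The infimum is attained because `hupper` shows the set to be nonempty; on an empty set `sInf`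
  -- would be 0.
  have hmem : pebblingHalf (hypercubeGraph (2 ^ j * d)) ∈
      {k : ℕ | (1 / 2 : ℝ) ≤ solvableProb (hypercubeGraph (2 ^ j * d)) k} :=
    Nat.sInf_mem ⟨_, hupper _ (Nat.le_mul_of_pos_left _ (by positivity))⟩
  exact absurd hlt (not_lt.2 hmem)

theorem mainTheorem5 :
    (¬ ∃ C : ℝ, ∀ (V W : Type) [Finite V] [Finite W] (G : SimpleGraph V) (H : SimpleGraph W),
      G.Connected → H.Connected →
        (pebblingHalf (SimpleGraph.boxProd G H) : ℝ)
          ≤ C * (pebblingHalf G : ℝ) * (pebblingHalf H : ℝ)) ∧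
    (¬ ∃ C : ℝ, ∀ n : ℕ, 1 ≤ n →
        (pebblingHalf (SimpleGraph.boxProd (hypercubeGraph n) (hypercubeGraph n)) : ℝ)
          ≤ C * (pebblingHalf (hypercubeGraph n) : ℝ) * (pebblingHalf (hypercubeGraph n) : ℝ)) := by
  refine ⟨?_, not_exists_pebblingHalf_hypercube_le⟩
  rintro ⟨C, hC⟩
  exact not_exists_pebblingHalf_hypercube_le ⟨C, fun n _ => hC _ _ _ _
    (hypercubeGraph_connected n) (hypercubeGraph_connected n)⟩
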